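/- **Setting.** Finitely many agents (UAVs) $n$ learn simultaneously. Agent $n$ has a finite state space $S_n$ (its position and transmit power); all agents have the same finite nonempty action space $A$ (direction and power change). Let $0\le\beta<1$, and let $P^n_{s\to s'}[a]$ be transition probabilities of agent $n$. At update $t=0,1,2,\dots$ agent $n$ is in state $s^n_t$, takes action $a^n_t$, receives a reward $r^n_t$, which may depend on the states and actions of all agents, and observes a successor state $\sigma^n_t$; its learning rate is $\alpha^n_t\in[0,1]$. Starting from any fixed tables $MQ^n_0$, only the entry of the visited pair is updated: $$MQ^n_{t+1}(s^n_t,a^n_t)=(1-\alpha^n_t)\,MQ^n_t(s^n_t,a^n_t)+\alpha^n_t\Big(r^n_t+\beta\max_{b\in A}MQ^n_t(\sigma^n_t,b)\Big).$$ When an agent does not explore, it chooses its action in $\arg\max_a\sum_j MQ^j_t(s^j_t,a)$; exploratory actions are arbitrary. Within an episode $s^n_{t+1}=\sigma^n_t$; at the start of an episode the states are re-initialized. Let $(\mathcal F^n_t)_t$ be a filtration (the information of agent $n$ just after it chose $a^n_t$) such that $s^n_t,a^n_t,\alpha^n_t$ are $\mathcal F^n_t$-measurable, $r^n_t,\sigma^n_t$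 are $\mathcal F^n_{t+1}$-measurable, the rewards are bounded by a constant, and $\Pr(\sigma^n_t=y\mid\mathcal F^n_t)=P^n_{s^n_t\to y}[a^n_t]$. Assume the Robbins–Monro conditions along the updates of each table entry: for all $n,s,a$, almost surely $$\sum_{t:(s^n_t,a^n_t)=(s,a)}\alpha^n_t=\infty,\qquad \sum_{t:(s^n_t,a^n_t)=(s,a)}(\alpha^n_t)^2<\infty .$$ **The optimal state $\mathbf{MQ}^*[k]$.** Put $\bar r^n_t=\mathbb E[r^n_t\mid\mathcal F^n_t]$. Let $MQ^{n*}(\langle s,k\rangle,a)$ be the optimal (over policies choosing an action from the current state and level) expected discounted value, with discount $\beta$, of taking $a$ at node $\langle s,k\rangle$ of the following process, built on a deck of cards recording the first $k$ updates of agent $n$. The bottom card pays $MQ^n_0(s,a)$. At node $\langle s,k+1\rangle$ with action $a$, if the top card records a pair other than $(s,a)$, it is discarded and one continues at $\langle s,k\rangle$ with $a$. If it records $(s,a)$, then with probability $1-\alpha^n_k$ it is discarded in the same way, and with probability $\alpha^n_k$ it pays $\bar r^n_k$ and the process moves to $\langle s',k\rangle$, with $s'$ drawn from $P^n_{s\to\cdot}[a]$,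 where a new action is chosen. Thus $$MQ^{n*}(\langle s,k+1\rangle,a)=(1-\alpha^n_k)MQ^{n*}(\langle s,k\rangle,a)+\alpha^n_k\Big[\bar r^n_k+\beta\sum_{s'}P^n_{s\to s'}[a]\max_b MQ^{n*}(\langle s',k\rangle,b)\Big]$$ if $(s^n_k,a^n_k)=(s,a)$, and $MQ^{n*}(\langle s,k+1\rangle,a)=MQ^{n*}(\langle s,k\rangle,a)$ otherwise. **Theorem.** (a) Multi-agent Q-learning $\mathbf{MQ}_{k+1}$ converges to the optimal state $\mathbf{MQ}^*[k+1]$: almost surely, for all agents $n$ and all $s,a$, $$MQ^n_{k+1}(s,a)-MQ^{n*}(\langle s,k+1\rangle,a)\to0\qquad(k\to\infty).$$ (b) If, for an agent $n$ and a function $\rho:S_n\times A\to\mathbb R$, almost surely $\bar r^n_t-\rho(s^n_t,a^n_t)\to0$ as $t\to\infty$ (in particular for a single agent whose expected reward is a function of its state and action, and whenever the strategies of the other agents settle so that agent $n$'s expected reward does), then almost surely $MQ^n_{k+1}(s,a)\to Q^*(s,a)$ for all $s,a$, where $Q^*$ is the optimal Q-function, i.e. the supremum over policies of $\mathbb E\big[\sum_{i\ge0}\beta^i\rho(s_i,a_i)\big]$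 with $(s_0,a_0)=(s,a)$, of the Markov decision process with transition probabilities $P^n$ and reward $\rho$. -/

import Mathlib

open MeasureTheory Filter Topology

noncomputable section

namespace MultiAgentQ

/-- The greedy value `max_b q(y, b)` of a Q-table `q` at the state `y`. -/
def greedyValue {S A : Type*} [Fintype A] [Nonempty A] (q : S → A → ℝ) (y : S) : ℝ :=
  Finset.univ.sup' Finset.univ_nonempty (q y)

/-- Tabular Q-learning along a sequence of experiences.  At update `k` the agent is in state `s k`,
takes action `a k`, receives `r k`, observes the successor `s' k` and uses the learning rate `α k`.
Only the entry of the visited pair changes: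
`Q(s,a) ← (1 - α) Q(s,a) + α (r + β max_b Q(s',b))`. -/
def qTable {S A : Type*} [DecidableEq S] [Fintype A] [Nonempty A] [DecidableEq A]
    (β : ℝ) (q₀ : S → A → ℝ) (s : ℕ → S) (a : ℕ → A) (s' : ℕ → S) (r α : ℕ → ℝ) :
    ℕ → S → A → ℝ
  | 0 => q₀
  | k + 1 => fun x b =>
      if s k = x ∧ a k = b then
        (1 - α k) * qTable β q₀ s a s' r α k x b
          + α k * (r k + β * greedyValue (qTable β q₀ s a s' r α k) (s' k))
      else qTable β q₀ s a s' r α k x b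

/-- The value, under the policy `π`, of taking action `b` at the node `⟨x, k⟩` of the deck whose
cards are the first `k` experiences.  The cards are inspected from the top.  A card recording
another state-action pair is thrown away.  A card recording `(x, b)` is thrown away with
probability `1 - α`; with probability `α` it pays its reward and the process moves to `⟨y, k⟩`, the
node with the remaining cards, with `y` drawn from `P x b`, where it continues with the action
`π k y` and discount `β`.  The bottom card pays the initial value `q₀`. -/
def deckValue {S A : Type*} [Fintype S] [DecidableEq S] [DecidableEq A]
    (P : S → A → PMF S) (β : ℝ) (q₀ : S → A → ℝ) (s : ℕ → S) (a : ℕ → A) (r α : ℕ → ℝ)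
    (π : ℕ → S → A) : ℕ → S → A → ℝ
  | 0 => q₀
  | k + 1 => fun x b =>
      if s k = x ∧ a k = b then
        (1 - α k) * deckValue P β q₀ s a r α π k x b
          + α k * (r k + β * ∑ y, (P x b y).toReal * deckValue P β q₀ s a r α π k y (π k y))
      else deckValue P β q₀ s a r α π k x b

/-- The optimal action value at the node `⟨x, k⟩` of the deck. -/
def deckOptimal {S A : Type*} [Fintype S] [DecidableEq S] [DecidableEq A]
    (P : S → A → PMF S) (β : ℝ) (q₀ : S → A → ℝ) (s : ℕ → S) (a : ℕ → A) (r α : ℕ → ℝ)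
    (k : ℕ) (x : S) (b : A) : ℝ :=
  ⨆ π : ℕ → S → A, deckValue P β q₀ s a r α π k x b

/-- The law of the state-action pair after `i` steps of the controlled chain with kernel `P`,
started with action `b` in state `x` and continued with the policy `π`. -/
def pairLaw {S A : Type*} (P : S → A → PMF S) (π : ℕ → S → A) (x : S) (b : A) : ℕ → PMF (S × A)
  | 0 => PMF.pure (x, b)
  | i + 1 => (pairLaw P π x b i).bind fun p => (P p.1 p.2).map fun y => (y, π i y)

/-- The expected cumulative discounted reward `E[∑ i, β ^ i * ρ(s_i, a_i)]` of the policy `π`. -/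
def expectedReturn {S A : Type*} [Fintype S] [Fintype A] (P : S → A → PMF S) (ρ : S → A → ℝ)
    (β : ℝ) (π : ℕ → S → A) (x : S) (b : A) : ℝ :=
  ∑' i : ℕ, β ^ i * ∑ p : S × A, (pairLaw P π x b i p).toReal * ρ p.1 p.2

/-- The optimal Q-function of the Markov decision process with kernel `P` and reward `ρ`. -/
def optimalQ {S A : Type*} [Fintype S] [Fintype A] (P : S → A → PMF S) (ρ : S → A → ℝ)
    (β : ℝ) (x : S) (b : A) : ℝ :=
  ⨆ π : ℕ → S → A, expectedReturn P ρ β π x b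

/-- The random data generated by several learning agents (UAVs) `n : ι` on `Ω`.  Agent `n` has the
states `S n`; all agents have the actions `A`. -/
structure Run (ι : Type*) (S : ι → Type*) (A Ω : Type*) where
  /-- initial Q-tables -/
  init : ∀ n, S n → A → ℝ
  /-- state of agent `n` at update `t` -/
  state : ∀ n, ℕ → Ω → S n
  /-- action of agent `n` at update `t` -/
  action : ι → ℕ → Ω → A
  /-- successor state observed by agent `n` at update `t` -/
  next : ∀ n, ℕ → Ω → S n
  /-- reward of agent `n` at update `t`; it may depend on all agents' states and actions -/
  reward : ι → ℕ → Ω → ℝ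
  /-- learning rate of agent `n` at update `t` -/
  rate : ι → ℕ → Ω → ℝ

section

variable {ι : Type*} {S : ι → Type*} {A Ω : Type*} [∀ n, DecidableEq (S n)] [Fintype A]
  [Nonempty A] [DecidableEq A]

/-- The Q-table of agent `n` after `k` updates. -/
def Run.MQ (R : Run ι S A Ω) (β : ℝ) (k : ℕ) (ω : Ω) (n : ι) : S n → A → ℝ :=
  qTable β (R.init n) (fun t => R.state n t ω) (fun t => R.action n t ω) (fun t => R.next n t ω)
    (fun t => R.reward n t ω) (fun t => R.rate n t ω) k

/-- The reward agent `n` expects at update `t` given its information `ℱ n t`. -/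
def Run.meanReward [mΩ : MeasurableSpace Ω] (R : Run ι S A Ω) (μ : Measure Ω)
    (ℱ : ι → Filtration ℕ mΩ) (n : ι) (t : ℕ) : Ω → ℝ :=
  μ[R.reward n t | ℱ n t]

/-- The optimal values of agent `n` at level `k`: those of the deck of its first `k` experiences,
with its transition probabilities and expected rewards. -/
def Run.MQstar [mΩ : MeasurableSpace Ω] [∀ n, Fintype (S n)] (R : Run ι S A Ω) (μ : Measure Ω)
    (ℱ : ι → Filtration ℕ mΩ) (P : ∀ n, S n → A → PMF (S n)) (β : ℝ) (k : ℕ) (ω : Ω) (n : ι) :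
    S n → A → ℝ :=
  deckOptimal (P n) β (R.init n) (fun t => R.state n t ω) (fun t => R.action n t ω)
    (fun t => R.meanReward μ ℱ n t ω) (fun t => R.rate n t ω) k

/-- `R` is a run of the multi-agent Q-learning algorithm.  `ℱ n t` is the information of agent `n`
just after it has chosen its action at update `t`; `newEpisode` holds the updates at which the
states are re-initialized; `explore n t ω` says that agent `n` draws its action at random at
update `t` instead of following the cooperative greedy rule. -/
structure IsMultiAgentQLearning [mΩ : MeasurableSpace Ω] [Fintype ι]
    (R : Run ι S A Ω) (μ : Measure Ω)
    (ℱ : ι → Filtration ℕ mΩ) (P : ∀ n, S n → A → PMF (S n)) (β : ℝ)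
    (newEpisode : Set ℕ) (explore : ι → ℕ → Ω → Prop) : Prop where
  state_meas : ∀ n t x, MeasurableSet[ℱ n t] {ω | R.state n t ω = x}
  action_meas : ∀ n t b, MeasurableSet[ℱ n t] {ω | R.action n t ω = b}
  rate_meas : ∀ n t, Measurable[ℱ n t] (R.rate n t)
  next_meas : ∀ n t x, MeasurableSet[ℱ n (t + 1)] {ω | R.next n t ω = x}
  reward_meas : ∀ n t, Measurable[ℱ n (t + 1)] (R.reward n t)
  /-- the rewards are bounded -/
  reward_bdd : ∃ C : ℝ, ∀ n t ω, |R.reward n t ω| ≤ C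
  /-- the successor of agent `n` is drawn from its transition probabilities -/
  transition : ∀ n t x,
    μ[{ω | R.next n t ω = x}.indicator (fun _ => (1 : ℝ)) | ℱ n t]
      =ᵐ[μ] fun ω => (P n (R.state n t ω) (R.action n t ω) x).toReal
  /-- within an episode the observed successor becomes the next state -/
  continuing : ∀ t, t + 1 ∉ newEpisode → ∀ n ω, R.state n (t + 1) ω = R.next n t ω
  /-- when not exploring, an agent maximizes the sum of the rows shared by all agents -/
  greedy : ∀ n t ω, ¬ explore n t ω → ∀ b,
    ∑ j, R.MQ β t ω j (R.state j t ω) b ≤ ∑ j, R.MQ β t ω j (R.state j t ω) (R.action n t ω)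

/-- The step-size conditions: the rates lie in `[0, 1]` and, almost surely, along the updates of
every entry of every Q-table they have infinite sum and finite sum of squares. -/
structure RobbinsMonro [MeasurableSpace Ω] (R : Run ι S A Ω) (μ : Measure Ω) : Prop where
  mem_Icc : ∀ n t ω, R.rate n t ω ∈ Set.Icc (0 : ℝ) 1
  sum_infinite : ∀ n x b, ∀ᵐ ω ∂μ, Tendsto (fun T => ∑ t ∈ Finset.range T,
    if R.state n t ω = x ∧ R.action n t ω = b then R.rate n t ω else 0) atTop atTop
  sum_sq_finite : ∀ n x b, ∀ᵐ ω ∂μ, Summable (fun t =>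
    if R.state n t ω = x ∧ R.action n t ω = b then R.rate n t ω ^ 2 else 0)

end

end MultiAgentQ

end

/-! Each agent can be treated alone: the others enter only through its rewards, whose conditional
means are exactly what the deck pays. A Q-table and the optimal deck values change at the same
entries with the same rates; they differ in that learning uses a sampled reward and successor where
the deck uses their conditional means. The entrywise difference `D` therefore obeys `D ← (1 - g) D +
g (w + δ + β e)`, with `g` the rate at the visited entry and `0` elsewhere, `w` a bounded martingale
difference, `δ` a vanishing error, and `|e|` at most the sup norm of `D`, because a maximum and a
transition average are both nonexpansive.

Such a recursion tends to `0` (`tendsto_zero_of_contraction`). Averaged noise dies out, so an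
eventual bound `c` on `|D|` improves to `β c + ε` for every `ε > 0`; the infimum of the eventual
bounds must then be `0`. The probabilistic input is that `∑ g w` converges almost surely: it is a
martingale, square-summability of the rates bounds it in L² after truncation, and Doob's convergence
theorem applies (`ae_exists_tendsto_of_summable_sq`).

For (a), `δ = 0`, and the deck optimum solves its optimality recursion by backward induction
(`deckOptimal_eq_deckBellman`). For (b), the same recursion compares the table with the fixed point
of the Bellman operator, with `δ` the gap between the expected reward and `ρ`; that fixed point is
the optimal Q-function (`eq_optimalQ_of_bellman`). -/

noncomputable section

namespace MultiAgentQ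

/-! ### Deterministic stochastic approximation -/

section Deterministic

/-- A sequence that is averaged with weights of infinite sum towards values at most `c` is
eventually at most `c + ε`. -/
lemma eventually_le_of_averaging {u α : ℕ → ℝ} {c ε : ℝ} (hε : 0 < ε)
    (hα : ∀ t, α t ∈ Set.Icc (0 : ℝ) 1)
    (hsum : Tendsto (fun T => ∑ t ∈ Finset.range T, α t) atTop atTop)
    (h : ∀ᶠ t in atTop, u (t + 1) ≤ (1 - α t) * u t + α t * c) :
    ∀ᶠ t in atTop, u t ≤ c + ε := by
  obtain ⟨T, hT⟩ := eventually_atTop.1 h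
  set S : ℕ → ℝ := fun T => ∑ t ∈ Finset.range T, α t with hS
  -- The positive part, so that replacing `1 - α` by the larger `exp (-α)` below keeps the
  -- inequality.
  set K : ℝ := max (u T - c) 0 with hK
  have hK0 : 0 ≤ K := le_max_right _ _
  have key : ∀ t, T ≤ t → u t - c ≤ Real.exp (-(S t - S T)) * K := by
    intro t ht
    induction t, ht using Nat.le_induction with
    | base => simp [hK]
    | succ t ht ih =>
      have h1 := hT t ht
      have h2 : 1 - α t ≤ Real.exp (-α t) := by
        have := Real.add_one_le_exp (-α t); linarith
      have h3 : 0 ≤ 1 - α t := by linarith [(hα t).2]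
      have h4 : S (t + 1) = S t + α t := by simp [hS, Finset.sum_range_succ]
      calc u (t + 1) - c ≤ (1 - α t) * (u t - c) := by linarith
        _ ≤ (1 - α t) * (Real.exp (-(S t - S T)) * K) := by gcongr
        _ ≤ Real.exp (-α t) * (Real.exp (-(S t - S T)) * K) := by gcongr
        _ = Real.exp (-(S (t + 1) - S T)) * K := by
          rw [← mul_assoc, ← Real.exp_add, h4]; ring_nf
  have hlim : Tendsto (fun t => Real.exp (-(S t - S T)) * K) atTop (𝓝 0) := by
    have h1 : Tendsto (fun t => S t - S T) atTop atTop :=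
      tendsto_atTop_add_const_right _ (-S T) hsum
    simpa using (Real.tendsto_exp_neg_atTop_nhds_zero.comp h1).mul_const K
  filter_upwards [hlim.eventually_lt_const hε, eventually_ge_atTop T] with t h1 h2
  linarith [key t h2]

/-- Averages of a sequence tending to `0`, with weights of infinite sum, tend to `0`. -/
lemma tendsto_zero_of_averaging {u α δ : ℕ → ℝ}
    (hα : ∀ t, α t ∈ Set.Icc (0 : ℝ) 1)
    (hsum : Tendsto (fun T => ∑ t ∈ Finset.range T, α t) atTop atTop)
    (hδ : Tendsto δ atTop (𝓝 0)) (h : ∀ t, u (t + 1) = (1 - α t) * u t + α t * δ t) :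
    Tendsto u atTop (𝓝 0) := by
  rw [Metric.tendsto_atTop']
  intro ε hε
  have h1 : ∀ᶠ t in atTop, |u t| ≤ ε / 3 + ε / 3 := by
    refine eventually_le_of_averaging (by positivity) hα hsum ?_
    have h2 : ∀ᶠ t in atTop, |δ t| < ε / 3 := by
      have := (hδ.abs); rw [abs_zero] at this
      exact this.eventually_lt_const (by positivity)
    filter_upwards [h2] with t ht
    have h3 : 0 ≤ 1 - α t := by linarith [(hα t).2]
    have h4 := (hα t).1
    rw [h t]
    calc |(1 - α t) * u t + α t * δ t| ≤ |(1 - α t) * u t| + |α t * δ t| := abs_add_le _ _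
      _ = (1 - α t) * |u t| + α t * |δ t| := by
        rw [abs_mul, abs_mul, abs_of_nonneg h3, abs_of_nonneg h4]
      _ ≤ _ := by gcongr
  obtain ⟨N, hN⟩ := eventually_atTop.1 h1
  refine ⟨N, fun t ht => ?_⟩
  rw [Real.dist_eq, sub_zero]
  linarith [hN t ht.le]

/-- Averaged noise vanishes if the weighted noise is summable in the sense of partial sums. -/
lemma tendsto_zero_of_noise {W α w : ℕ → ℝ} {l : ℝ}
    (hα : ∀ t, α t ∈ Set.Icc (0 : ℝ) 1)
    (hsum : Tendsto (fun T => ∑ t ∈ Finset.range T, α t) atTop atTop)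
    (hw : Tendsto (fun T => ∑ t ∈ Finset.range T, α t * w t) atTop (𝓝 l))
    (h : ∀ t, W (t + 1) = (1 - α t) * W t + α t * w t) :
    Tendsto W atTop (𝓝 0) := by
  set M : ℕ → ℝ := fun T => ∑ t ∈ Finset.range T, α t * w t with hM
  have hMl : Tendsto (fun t => l - M t) atTop (𝓝 0) := by
    simpa using hw.const_sub l
  -- Adding the remaining tail `l - M` of the noise series cancels `α w` from the recursion: the sum
  -- is an average of the tail itself, which tends to `0`.
  have hU : Tendsto (fun t => W t + (l - M t)) atTop (𝓝 0) := by
    refine tendsto_zero_of_averaging hα hsum hMl fun t => ?_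
    have : M (t + 1) = M t + α t * w t := by simp [hM, Finset.sum_range_succ]
    rw [h t, this]; ring
  simpa using hU.sub hMl

/-- The noise with weights `α`, averaged from the start value `0`. -/
def noiseAverage (α w : ℕ → ℝ) : ℕ → ℝ
  | 0 => 0
  | t + 1 => (1 - α t) * noiseAverage α w t + α t * w t

/-- Convergence of asynchronous stochastic approximation with a sup-norm contraction. -/
lemma tendsto_zero_of_contraction {κ : Type*} [Finite κ] {D g e : ℕ → κ → ℝ} {w δ : ℕ → ℝ}
    {β B : ℝ} (hβ₀ : 0 ≤ β) (hβ₁ : β < 1) (hg : ∀ t i, g t i ∈ Set.Icc (0 : ℝ) 1)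
    (hsum : ∀ i, Tendsto (fun T => ∑ t ∈ Finset.range T, g t i) atTop atTop)
    (hw : ∀ i, ∃ l, Tendsto (fun T => ∑ t ∈ Finset.range T, g t i * w t) atTop (𝓝 l))
    (hδ : Tendsto δ atTop (𝓝 0)) (hB : ∀ t i, |D t i| ≤ B)
    (he : ∀ t i c, (∀ j, |D t j| ≤ c) → |e t i| ≤ c)
    (hD : ∀ t i, D (t + 1) i = (1 - g t i) * D t i + g t i * (w t + δ t + β * e t i)) (i : κ) :
    Tendsto (fun t => D t i) atTop (𝓝 0) := by
  -- The eventual uniform bounds on `D`; the goal is that their infimum is `0`.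
  set I : Set ℝ := {c | 0 ≤ c ∧ ∀ᶠ t in atTop, ∀ j, |D t j| ≤ c} with hI
  have hImp : ∀ c ∈ I, ∀ ε > 0, β * c + ε ∈ I := by
    rintro c ⟨hc, hcD⟩ ε hε
    refine ⟨by positivity, ?_⟩
    rw [eventually_all]
    intro j
    have hW : Tendsto (noiseAverage (fun t => g t j) w) atTop (𝓝 0) := by
      obtain ⟨l, hl⟩ := hw j
      exact tendsto_zero_of_noise (fun t => hg t j) (hsum j) hl fun t => rfl
    have hW' : ∀ᶠ t in atTop, |noiseAverage (fun t => g t j) w t| < ε / 3 := by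
      have := hW.abs; rw [abs_zero] at this
      exact this.eventually_lt_const (by positivity)
    have hδ' : ∀ᶠ t in atTop, |δ t| < ε / 3 := by
      have := hδ.abs; rw [abs_zero] at this
      exact this.eventually_lt_const (by positivity)
    -- By linearity, removing the averaged noise leaves a recursion driven by `δ + β e` alone,
    -- eventually at most `β c + ε / 3`.
    have hZ : ∀ᶠ t in atTop, |D t j - noiseAverage (fun t => g t j) w t|
        ≤ (β * c + ε / 3) + ε / 3 := by
      refine eventually_le_of_averaging (by positivity) (fun t => hg t j) (hsum j) ?_
      filter_upwards [hδ', hcD] with t h1 h2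
      have h3 : 0 ≤ 1 - g t j := by linarith [(hg t j).2]
      have h4 := (hg t j).1
      have h5 := he t j c h2
      have h6 : |δ t + β * e t j| ≤ β * c + ε / 3 := by
        calc |δ t + β * e t j| ≤ |δ t| + |β * e t j| := abs_add_le _ _
          _ = |δ t| + β * |e t j| := by rw [abs_mul, abs_of_nonneg hβ₀]
          _ ≤ ε / 3 + β * c := by gcongr
          _ = _ := by ring
      have h7 : D (t + 1) j - noiseAverage (fun t => g t j) w (t + 1)
          = (1 - g t j) * (D t j - noiseAverage (fun t => g t j) w t)
            + g t j * (δ t + β * e t j) := by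
        rw [hD t j, noiseAverage]; ring
      rw [h7]
      refine (abs_add_le _ _).trans ?_
      rw [abs_mul, abs_mul, abs_of_nonneg h3, abs_of_nonneg h4]
      gcongr
    filter_upwards [hZ, hW'] with t h1 h2
    have := abs_add_le (D t j - noiseAverage (fun t => g t j) w t)
      (noiseAverage (fun t => g t j) w t)
    rw [sub_add_cancel] at this
    linarith
  have hne : I.Nonempty :=
    ⟨|B|, abs_nonneg _, Eventually.of_forall fun t j => (hB t j).trans (le_abs_self _)⟩
  have hbdd : BddBelow I := ⟨0, fun c hc => hc.1⟩
  have hL : sInf I ≤ 0 := by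
    by_contra! hpos
    set L := sInf I
    -- With `η = (1 - β) L / 4` and `c < L + η`, the improved bound `β c + η` is below `β L + 2 η`,
    -- which is less than `L`: a contradiction.
    have hη : 0 < (1 - β) * L / 4 := by have : 0 < 1 - β := by linarith
                                        positivity
    obtain ⟨c, hc, hcL⟩ := exists_lt_of_csInf_lt hne (lt_add_of_pos_right L hη)
    have h1 : L ≤ β * c + (1 - β) * L / 4 := csInf_le hbdd (hImp c hc _ hη)
    have h2 : β * c ≤ β * (L + (1 - β) * L / 4) := by gcongr
    have h3 : β * ((1 - β) * L / 4) ≤ 1 * ((1 - β) * L / 4) := by gcongr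
    nlinarith
  rw [Metric.tendsto_atTop']
  intro ε hε
  obtain ⟨c, hc, hcε⟩ := exists_lt_of_csInf_lt hne (hL.trans_lt hε)
  obtain ⟨N, hN⟩ := eventually_atTop.1 hc.2
  refine ⟨N, fun t ht => ?_⟩
  rw [Real.dist_eq, sub_zero]
  exact (hN t ht.le i).trans_lt hcε

end Deterministic

/-! ### Nonexpansiveness of maxima and transition averages -/

section Greedy

variable {S A : Type*} [Fintype A] [Nonempty A]

lemma le_greedyValue (q : S → A → ℝ) (y : S) (b : A) : q y b ≤ greedyValue q y :=
  Finset.le_sup' (q y) (Finset.mem_univ b)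

lemma exists_eq_greedyValue (q : S → A → ℝ) (y : S) : ∃ b, q y b = greedyValue q y := by
  obtain ⟨b, -, hb⟩ := Finset.exists_mem_eq_sup' (Finset.univ_nonempty (α := A)) (q y)
  exact ⟨b, hb.symm⟩

lemma abs_greedyValue_le {q : S → A → ℝ} {y : S} {c : ℝ} (h : ∀ b, |q y b| ≤ c) :
    |greedyValue q y| ≤ c := by
  obtain ⟨b, hb⟩ := exists_eq_greedyValue q y
  rw [← hb]; exact h b

/-- A maximizer for one table competes in the other table's maximum, so neither maximum exceeds the
other by more than `c`. -/
lemma abs_greedyValue_sub_le {q q' : S → A → ℝ} {y : S} {c : ℝ}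
    (h : ∀ b, |q y b - q' y b| ≤ c) : |greedyValue q y - greedyValue q' y| ≤ c := by
  obtain ⟨b, hb⟩ := exists_eq_greedyValue q y
  obtain ⟨b', hb'⟩ := exists_eq_greedyValue q' y
  have h1 := le_greedyValue q y b'
  have h2 := le_greedyValue q' y b
  rw [abs_le]
  constructor
  · linarith [(abs_le.1 (h b')).1]
  · linarith [(abs_le.1 (h b)).2]

lemma sum_toReal_pmf [Fintype S] (p : PMF S) : ∑ y, (p y).toReal = 1 := by
  rw [← ENNReal.toReal_sum fun y _ => p.apply_ne_top y, ← tsum_fintype (L := .unconditional S),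
    p.tsum_coe, ENNReal.toReal_one]

lemma abs_sum_pmf_mul_le [Fintype S] (p : PMF S) {f : S → ℝ} {c : ℝ} (h : ∀ y, |f y| ≤ c) :
    |∑ y, (p y).toReal * f y| ≤ c := by
  calc |∑ y, (p y).toReal * f y| ≤ ∑ y, |(p y).toReal * f y| := Finset.abs_sum_le_sum_abs _ _
    _ ≤ ∑ y, (p y).toReal * c := by
      refine Finset.sum_le_sum fun y _ => ?_
      rw [abs_mul, abs_of_nonneg ENNReal.toReal_nonneg]
      exact mul_le_mul_of_nonneg_left (h y) ENNReal.toReal_nonneg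
    _ = c := by rw [← Finset.sum_mul, sum_toReal_pmf, one_mul]

end Greedy

/-! ### A priori bounds -/

section Bound

variable {S A : Type*} [Fintype S] [Fintype A] {β : ℝ} {q₀ : S → A → ℝ}

/-- A bound preserved by discounted updates with rewards at most `C`. -/
def valueBound (β C : ℝ) (q₀ : S → A → ℝ) : ℝ := ∑ x, ∑ b, |q₀ x b| + |C| / (1 - β)

lemma abs_le_valueBound (hβ₁ : β < 1) (C : ℝ) (x : S) (b : A) :
    |q₀ x b| ≤ valueBound β C q₀ := by
  have h1 : |q₀ x b| ≤ ∑ b, |q₀ x b| :=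
    Finset.single_le_sum (f := fun b => |q₀ x b|) (fun _ _ => abs_nonneg _) (Finset.mem_univ b)
  have h2 : ∑ b, |q₀ x b| ≤ ∑ x, ∑ b, |q₀ x b| :=
    Finset.single_le_sum (f := fun x => ∑ b, |q₀ x b|)
      (fun _ _ => Finset.sum_nonneg fun _ _ => abs_nonneg _) (Finset.mem_univ x)
  have h3 : 0 ≤ |C| / (1 - β) := div_nonneg (abs_nonneg _) (by linarith)
  unfold valueBound
  linarith

lemma abs_update_le_valueBound (hβ₀ : 0 ≤ β) (hβ₁ : β < 1) {C c q ρ v : ℝ}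
    (hc : c ∈ Set.Icc (0 : ℝ) 1) (hq : |q| ≤ valueBound β C q₀) (hρ : |ρ| ≤ C)
    (hv : |v| ≤ valueBound β C q₀) :
    |(1 - c) * q + c * (ρ + β * v)| ≤ valueBound β C q₀ := by
  -- The summand `|C| / (1 - β)` is the fixed point of `v ↦ |C| + β v`; the initial-table part only
  -- shrinks under `β`.
  have hB : C + β * valueBound β C q₀ ≤ valueBound β C q₀ := by
    have h0 : 0 ≤ ∑ x, ∑ b, |q₀ x b| :=
      Finset.sum_nonneg fun _ _ => Finset.sum_nonneg fun _ _ => abs_nonneg _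
    have h1 : (1 - β) * valueBound β C q₀ = (1 - β) * (∑ x, ∑ b, |q₀ x b|) + |C| := by
      have : 1 - β ≠ 0 := by linarith
      unfold valueBound; field_simp
    have h2 : 0 ≤ (1 - β) * ∑ x, ∑ b, |q₀ x b| := mul_nonneg (by linarith) h0
    linarith [le_abs_self C]
  have h3 : 0 ≤ 1 - c := by linarith [hc.2]
  have h4 := hc.1
  calc |(1 - c) * q + c * (ρ + β * v)| ≤ (1 - c) * |q| + c * |ρ + β * v| := by
        refine (abs_add_le _ _).trans ?_
        rw [abs_mul, abs_mul, abs_of_nonneg h3, abs_of_nonneg h4]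
    _ ≤ (1 - c) * valueBound β C q₀ + c * (C + β * valueBound β C q₀) := by
        gcongr
        refine (abs_add_le _ _).trans ?_
        rw [abs_mul, abs_of_nonneg hβ₀]
        gcongr
    _ ≤ (1 - c) * valueBound β C q₀ + c * valueBound β C q₀ := by gcongr
    _ = _ := by ring

end Bound

/-! ### The deck and its comparison with Q-learning -/

section Deck

variable {S A : Type*} [Fintype S] [DecidableEq S] [Fintype A] [Nonempty A] [DecidableEq A]

/-- The solution of the optimality recursion of the deck. -/
def deckBellman (P : S → A → PMF S) (β : ℝ) (q₀ : S → A → ℝ) (s : ℕ → S) (a : ℕ → A)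
    (r α : ℕ → ℝ) : ℕ → S → A → ℝ
  | 0 => q₀
  | k + 1 => fun x b =>
      if s k = x ∧ a k = b then
        (1 - α k) * deckBellman P β q₀ s a r α k x b
          + α k * (r k + β * ∑ y, (P x b y).toReal *
              greedyValue (deckBellman P β q₀ s a r α k) y)
      else deckBellman P β q₀ s a r α k x b

variable {P : S → A → PMF S} {β : ℝ} {q₀ : S → A → ℝ} {s : ℕ → S} {a : ℕ → A} {r α : ℕ → ℝ}

/-- All coefficients are nonnegative, so a node's value is monotone in the values one card below. -/
lemma deckValue_le_deckBellman (hβ : 0 ≤ β) (hα : ∀ k, α k ∈ Set.Icc (0 : ℝ) 1)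
    (π : ℕ → S → A) (k : ℕ) (x : S) (b : A) :
    deckValue P β q₀ s a r α π k x b ≤ deckBellman P β q₀ s a r α k x b := by
  induction k generalizing x b with
  | zero => exact le_rfl
  | succ k ih =>
    simp only [deckValue, deckBellman]
    have h0 := (hα k).1
    have h1 : 0 ≤ 1 - α k := by linarith [(hα k).2]
    split_ifs
    · gcongr with y
      · exact ih x b
      · exact (ih _ _).trans (le_greedyValue _ _ _)
    · exact ih x b

/-- Policies may depend on the level, so one policy can be greedy at every level at once and attain
all the optima. -/
lemma exists_deckValue_eq_deckBellman :
    ∃ π : ℕ → S → A, ∀ k x b,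
      deckValue P β q₀ s a r α π k x b = deckBellman P β q₀ s a r α k x b := by
  choose π hπ using fun k y => exists_eq_greedyValue (deckBellman P β q₀ s a r α k) y
  refine ⟨π, fun k => ?_⟩
  induction k with
  | zero => intro x b; rfl
  | succ k ih => intro x b; simp only [deckValue, deckBellman, ih, hπ]

lemma deckOptimal_eq_deckBellman (hβ : 0 ≤ β) (hα : ∀ k, α k ∈ Set.Icc (0 : ℝ) 1)
    (k : ℕ) (x : S) (b : A) :
    deckOptimal P β q₀ s a r α k x b = deckBellman P β q₀ s a r α k x b := by
  obtain ⟨π, hπ⟩ := exists_deckValue_eq_deckBellman (P := P) (β := β) (q₀ := q₀) (s := s)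
    (a := a) (r := r) (α := α)
  refine le_antisymm (ciSup_le fun π' => deckValue_le_deckBellman hβ hα π' k x b) ?_
  rw [← hπ]
  exact le_ciSup (f := fun π => deckValue P β q₀ s a r α π k x b)
    ⟨_, Set.forall_mem_range.2 fun π' => deckValue_le_deckBellman hβ hα π' k x b⟩ π

lemma abs_qTable_le (hβ₀ : 0 ≤ β) (hβ₁ : β < 1) {s' : ℕ → S} {C : ℝ}
    (hα : ∀ k, α k ∈ Set.Icc (0 : ℝ) 1) (hr : ∀ k, |r k| ≤ C) (k : ℕ) (x : S) (b : A) :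
    |qTable β q₀ s a s' r α k x b| ≤ valueBound β C q₀ := by
  induction k generalizing x b with
  | zero => exact abs_le_valueBound hβ₁ C x b
  | succ k ih =>
    simp only [qTable]
    split_ifs
    · exact abs_update_le_valueBound hβ₀ hβ₁ (hα k) (ih x b) (hr k)
        (abs_greedyValue_le fun b => ih _ b)
    · exact ih x b

lemma abs_deckBellman_le (hβ₀ : 0 ≤ β) (hβ₁ : β < 1) {C : ℝ}
    (hα : ∀ k, α k ∈ Set.Icc (0 : ℝ) 1) (hr : ∀ k, |r k| ≤ C) (k : ℕ) (x : S) (b : A) :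
    |deckBellman P β q₀ s a r α k x b| ≤ valueBound β C q₀ := by
  induction k generalizing x b with
  | zero => exact abs_le_valueBound hβ₁ C x b
  | succ k ih =>
    simp only [deckBellman]
    split_ifs
    · exact abs_update_le_valueBound hβ₀ hβ₁ (hα k) (ih x b) (hr k)
        (abs_sum_pmf_mul_le _ fun y => abs_greedyValue_le fun b => ih _ b)
    · exact ih x b

/-- The noise of the `k`-th update of a Q-table, relative to expected rewards `r'`. -/
def updateNoise (P : S → A → PMF S) (β : ℝ) (q : S → A → ℝ) (x y : S) (b : A) (r r' : ℝ) : ℝ :=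
  r - r' + β * (greedyValue q y - ∑ z, (P x b z).toReal * greedyValue q z)

variable {s' : ℕ → S} {r' : ℕ → ℝ} {C : ℝ}

/-- On a sample path along which the noise is summable, Q-learning follows the deck. -/
lemma tendsto_qTable_sub_deckBellman (hβ₀ : 0 ≤ β) (hβ₁ : β < 1)
    (hα : ∀ k, α k ∈ Set.Icc (0 : ℝ) 1) (hr : ∀ k, |r k| ≤ C) (hr' : ∀ k, |r' k| ≤ C)
    (hsum : ∀ x b, Tendsto (fun T => ∑ t ∈ Finset.range T,
      if s t = x ∧ a t = b then α t else 0) atTop atTop)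
    (hw : ∀ x b, ∃ l, Tendsto (fun T => ∑ t ∈ Finset.range T,
      (if s t = x ∧ a t = b then α t else 0) *
        updateNoise P β (qTable β q₀ s a s' r α t) (s t) (s' t) (a t) (r t) (r' t))
      atTop (𝓝 l)) (x : S) (b : A) :
    Tendsto (fun k => qTable β q₀ s a s' r α k x b - deckBellman P β q₀ s a r' α k x b)
      atTop (𝓝 0) := by
  refine tendsto_zero_of_contraction (κ := S × A)
    (D := fun k i => qTable β q₀ s a s' r α k i.1 i.2 - deckBellman P β q₀ s a r' α k i.1 i.2)
    (g := fun t i => if s t = i.1 ∧ a t = i.2 then α t else 0)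
    (e := fun t i => ∑ y, (P i.1 i.2 y).toReal * (greedyValue (qTable β q₀ s a s' r α t) y
      - greedyValue (deckBellman P β q₀ s a r' α t) y))
    -- One noise sequence serves all entries: off the visited pair its weight is `0`.
    (w := fun t => updateNoise P β (qTable β q₀ s a s' r α t) (s t) (s' t) (a t) (r t) (r' t))
    (δ := fun _ => 0) (β := β) (B := valueBound β C q₀ + valueBound β C q₀)
    hβ₀ hβ₁ (fun t i => ?_) (fun i => hsum i.1 i.2) (fun i => hw i.1 i.2) tendsto_const_nhds
    (fun t i => ?_) (fun t i c hc => ?_) (fun t i => ?_) (x, b)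
  · split_ifs
    · exact hα t
    · simp
  · exact (abs_sub _ _).trans (add_le_add (abs_qTable_le hβ₀ hβ₁ hα hr _ _ _)
      (abs_deckBellman_le hβ₀ hβ₁ hα hr' _ _ _))
  · exact abs_sum_pmf_mul_le _ fun y => abs_greedyValue_sub_le fun b => hc (y, b)
  · simp only [qTable, deckBellman, updateNoise]
    split_ifs with h
    · rw [h.1, h.2]; simp only [mul_sub, Finset.sum_sub_distrib]; ring
    · ring

/-- On a sample path along which the noise is summable and the expected rewards settle,
Q-learning finds the solution of the Bellman equation. -/
lemma tendsto_qTable_of_bellman (hβ₀ : 0 ≤ β) (hβ₁ : β < 1)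
    (hα : ∀ k, α k ∈ Set.Icc (0 : ℝ) 1) (hr : ∀ k, |r k| ≤ C)
    (hsum : ∀ x b, Tendsto (fun T => ∑ t ∈ Finset.range T,
      if s t = x ∧ a t = b then α t else 0) atTop atTop)
    (hw : ∀ x b, ∃ l, Tendsto (fun T => ∑ t ∈ Finset.range T,
      (if s t = x ∧ a t = b then α t else 0) *
        updateNoise P β (qTable β q₀ s a s' r α t) (s t) (s' t) (a t) (r t) (r' t))
      atTop (𝓝 l)) {ρ q : S → A → ℝ}
    (hρ : Tendsto (fun t => r' t - ρ (s t) (a t)) atTop (𝓝 0))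
    (hq : ∀ x b, q x b = ρ x b + β * ∑ y, (P x b y).toReal * greedyValue q y) (x : S) (b : A) :
    Tendsto (fun k => qTable β q₀ s a s' r α k x b) atTop (𝓝 (q x b)) := by
  rw [← tendsto_sub_nhds_zero_iff]
  refine tendsto_zero_of_contraction (κ := S × A)
    (D := fun k i => qTable β q₀ s a s' r α k i.1 i.2 - q i.1 i.2)
    (g := fun t i => if s t = i.1 ∧ a t = i.2 then α t else 0)
    (e := fun t i => ∑ y, (P i.1 i.2 y).toReal * (greedyValue (qTable β q₀ s a s' r α t) y
      - greedyValue q y))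
    (w := fun t => updateNoise P β (qTable β q₀ s a s' r α t) (s t) (s' t) (a t) (r t) (r' t))
    (β := β) (B := valueBound β C q₀ + valueBound β 0 q)
    -- Here `hρ` fixes `δ` as the gap between the expected reward and `ρ` at the visited pair.
    hβ₀ hβ₁ (fun t i => ?_) (fun i => hsum i.1 i.2) (fun i => hw i.1 i.2) hρ
    (fun t i => ?_) (fun t i c hc => ?_) (fun t i => ?_) (x, b)
  · split_ifs
    · exact hα t
    · simp
  · exact (abs_sub _ _).trans (add_le_add (abs_qTable_le hβ₀ hβ₁ hα hr _ _ _)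
      (abs_le_valueBound hβ₁ 0 _ _))
  · exact abs_sum_pmf_mul_le _ fun y => abs_greedyValue_sub_le fun b => hc (y, b)
  · simp only [qTable, updateNoise]
    split_ifs with h
    · rw [h.1, h.2]; simp only [mul_sub, Finset.sum_sub_distrib]
      linear_combination (-α t) * hq i.1 i.2
    · ring

end Deck

/-! ### The Bellman equation and the optimal Q-function -/

section OptimalQ

variable {S A : Type*} {P : S → A → PMF S} {ρ : S → A → ℝ} {β : ℝ}

/-- After the first transition, the controlled chain runs with the shifted policy. -/
lemma pairLaw_succ_eq_bind (P : S → A → PMF S) (π : ℕ → S → A) (x : S) (b : A) (i : ℕ) :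
    pairLaw P π x b (i + 1)
      = (P x b).bind fun y => pairLaw P (fun k => π (k + 1)) y (π 0 y) i := by
  induction i with
  | zero => simp [pairLaw, PMF.map, Function.comp_def]
  | succ i ih =>
    rw [pairLaw, ih, PMF.bind_bind]
    rfl

variable [Fintype S] [Fintype A]

/-- The expected reward at step `i`. -/
def stepReward (P : S → A → PMF S) (ρ : S → A → ℝ) (π : ℕ → S → A) (x : S) (b : A) (i : ℕ) : ℝ :=
  ∑ p : S × A, (pairLaw P π x b i p).toReal * ρ p.1 p.2

lemma stepReward_zero (π : ℕ → S → A) (x : S) (b : A) : stepReward P ρ π x b 0 = ρ x b := by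
  classical
  simp only [stepReward, pairLaw, PMF.pure_apply]
  rw [Finset.sum_eq_single (x, b)] <;> simp +contextual

lemma stepReward_succ (π : ℕ → S → A) (x : S) (b : A) (i : ℕ) :
    stepReward P ρ π x b (i + 1)
      = ∑ y, (P x b y).toReal * stepReward P ρ (fun k => π (k + 1)) y (π 0 y) i := by
  simp only [stepReward, pairLaw_succ_eq_bind, PMF.bind_apply, Finset.mul_sum]
  rw [Finset.sum_comm]
  refine Finset.sum_congr rfl fun p _ => ?_
  rw [tsum_fintype, ENNReal.toReal_sum fun y _ =>
    ENNReal.mul_ne_top ((P x b).apply_ne_top y) (PMF.apply_ne_top _ _), Finset.sum_mul]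
  simp only [ENNReal.toReal_mul, mul_assoc]

lemma abs_stepReward_le {C : ℝ} (hρ : ∀ x b, |ρ x b| ≤ C) (π : ℕ → S → A) (x : S) (b : A)
    (i : ℕ) : |stepReward P ρ π x b i| ≤ C :=
  abs_sum_pmf_mul_le (pairLaw P π x b i) fun p => hρ p.1 p.2

lemma exists_abs_le (ρ : S → A → ℝ) : ∃ C, ∀ x b, |ρ x b| ≤ C :=
  ⟨valueBound 0 0 ρ, fun x b => abs_le_valueBound zero_lt_one 0 x b⟩

lemma summable_stepReward (hβ₀ : 0 ≤ β) (hβ₁ : β < 1) (π : ℕ → S → A) (x : S) (b : A) :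
    Summable fun i => β ^ i * stepReward P ρ π x b i := by
  obtain ⟨C, hC⟩ := exists_abs_le ρ
  refine Summable.of_norm_bounded
    ((summable_geometric_of_lt_one hβ₀ hβ₁).mul_right C) fun i => ?_
  rw [Real.norm_eq_abs, abs_mul, abs_of_nonneg (pow_nonneg hβ₀ i)]
  exact mul_le_mul_of_nonneg_left (abs_stepReward_le hC π x b i) (pow_nonneg hβ₀ i)

lemma abs_expectedReturn_le (hβ₀ : 0 ≤ β) (hβ₁ : β < 1) {C : ℝ} (hρ : ∀ x b, |ρ x b| ≤ C)
    (π : ℕ → S → A) (x : S) (b : A) : |expectedReturn P ρ β π x b| ≤ (1 - β)⁻¹ * C := by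
  have h := tsum_of_norm_bounded (f := fun i => β ^ i * stepReward P ρ π x b i)
    ((hasSum_geometric_of_lt_one hβ₀ hβ₁).mul_right C) fun i => by
      rw [Real.norm_eq_abs, abs_mul, abs_of_nonneg (pow_nonneg hβ₀ i)]
      exact mul_le_mul_of_nonneg_left (abs_stepReward_le hρ π x b i) (pow_nonneg hβ₀ i)
  exact h

/-- The return of a policy is the first reward plus the discounted return of the shifted policy. -/
lemma expectedReturn_eq (hβ₀ : 0 ≤ β) (hβ₁ : β < 1) (π : ℕ → S → A) (x : S) (b : A) :
    expectedReturn P ρ β π x b = ρ x b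
      + β * ∑ y, (P x b y).toReal * expectedReturn P ρ β (fun k => π (k + 1)) y (π 0 y) := by
  change ∑' i, β ^ i * stepReward P ρ π x b i = _
  rw [(summable_stepReward hβ₀ hβ₁ π x b).tsum_eq_zero_add, stepReward_zero, pow_zero, one_mul]
  congr 1
  change _ = β * ∑ y, (P x b y).toReal *
    ∑' i, β ^ i * stepReward P ρ (fun k => π (k + 1)) y (π 0 y) i
  simp only [← tsum_mul_left]
  rw [← Summable.tsum_finsetSum fun y _ => (summable_stepReward hβ₀ hβ₁ _ _ _).mul_left _,
    ← tsum_mul_left]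
  refine tsum_congr fun i => ?_
  rw [stepReward_succ, Finset.mul_sum, Finset.mul_sum]
  exact Finset.sum_congr rfl fun y _ => by ring

variable [Nonempty A]

/-- The Bellman optimality operator. -/
def bellmanOperator (P : S → A → PMF S) (ρ : S → A → ℝ) (β : ℝ) (q : S → A → ℝ) : S → A → ℝ :=
  fun x b => ρ x b + β * ∑ y, (P x b y).toReal * greedyValue q y

/-- Banach's fixed point theorem: the Bellman operator is a `β`-contraction for the sup distance. -/
lemma exists_bellman_solution (P : S → A → PMF S) (ρ : S → A → ℝ) (hβ₀ : 0 ≤ β) (hβ₁ : β < 1) :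
    ∃ q : S → A → ℝ, ∀ x b, q x b = ρ x b + β * ∑ y, (P x b y).toReal * greedyValue q y := by
  have hc : ContractingWith ⟨β, hβ₀⟩ (bellmanOperator P ρ β) := by
    refine ⟨by exact_mod_cast hβ₁, LipschitzWith.of_dist_le_mul fun q q' => ?_⟩
    have h0 : 0 ≤ β * dist q q' := by positivity
    refine (dist_pi_le_iff h0).2 fun x => (dist_pi_le_iff h0).2 fun b => ?_
    have h1 : bellmanOperator P ρ β q x b - bellmanOperator P ρ β q' x b
        = β * ∑ y, (P x b y).toReal * (greedyValue q y - greedyValue q' y) := by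
      simp only [bellmanOperator, mul_sub, Finset.sum_sub_distrib]; ring
    rw [Real.dist_eq, h1, abs_mul, abs_of_nonneg hβ₀]
    refine mul_le_mul_of_nonneg_left (abs_sum_pmf_mul_le _ fun y =>
      abs_greedyValue_sub_le fun c => ?_) hβ₀
    rw [← Real.dist_eq]
    exact (dist_le_pi_dist (q y) (q' y) c).trans (dist_le_pi_dist q q' y)
  exact ⟨ContractingWith.fixedPoint _ hc, fun x b =>
    (congrFun (congrFun hc.fixedPoint_isFixedPt x) b).symm⟩

/-- A solution of the Bellman equation is the optimal Q-function. -/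
lemma eq_optimalQ_of_bellman (hβ₀ : 0 ≤ β) (hβ₁ : β < 1) {q : S → A → ℝ}
    (hq : ∀ x b, q x b = ρ x b + β * ∑ y, (P x b y).toReal * greedyValue q y) (x : S) (b : A) :
    q x b = optimalQ P ρ β x b := by
  obtain ⟨C, hC⟩ := exists_abs_le ρ
  obtain ⟨D, hD⟩ := exists_abs_le q
  have hlim : Tendsto (fun m : ℕ => β ^ m * ((1 - β)⁻¹ * C + D)) atTop (𝓝 0) := by
    simpa using (tendsto_pow_atTop_nhds_zero_of_lt_one hβ₀ hβ₁).mul_const ((1 - β)⁻¹ * C + D)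
  have hbase (π : ℕ → S → A) (x : S) (b : A) :
      |expectedReturn P ρ β π x b - q x b| ≤ (1 - β)⁻¹ * C + D :=
    (abs_sub _ _).trans (add_le_add (abs_expectedReturn_le hβ₀ hβ₁ hC π x b) (hD x b))
  have hdiff (π : ℕ → S → A) (x : S) (b : A) : expectedReturn P ρ β π x b - q x b
      = β * ∑ y, (P x b y).toReal *
        (expectedReturn P ρ β (fun k => π (k + 1)) y (π 0 y) - greedyValue q y) := by
    rw [expectedReturn_eq hβ₀ hβ₁, hq x b]
    simp only [mul_sub, Finset.sum_sub_distrib]; ring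
  have hle (π : ℕ → S → A) (x : S) (b : A) : expectedReturn P ρ β π x b ≤ q x b := by
    -- Each unrolling of `hdiff` gains a factor `β` but shifts the policy, so the induction
    -- quantifies over all policies.
    have hm (m : ℕ) : ∀ (π : ℕ → S → A) (x : S) (b : A),
        expectedReturn P ρ β π x b - q x b ≤ β ^ m * ((1 - β)⁻¹ * C + D) := by
      induction m with
      | zero => intro π x b; simpa using (le_abs_self _).trans (hbase π x b)
      | succ m ih =>
        intro π x b
        rw [hdiff, pow_succ', mul_assoc]
        refine mul_le_mul_of_nonneg_left ?_ hβ₀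
        calc _ ≤ ∑ y, (P x b y).toReal * (β ^ m * ((1 - β)⁻¹ * C + D)) := by
              refine Finset.sum_le_sum fun y _ =>
                mul_le_mul_of_nonneg_left ?_ ENNReal.toReal_nonneg
              linarith [ih (fun k => π (k + 1)) y (π 0 y), le_greedyValue q y (π 0 y)]
          _ = _ := by rw [← Finset.sum_mul, sum_toReal_pmf, one_mul]
    linarith [ge_of_tendsto' hlim fun m => hm m π x b]
  choose g hg using fun y => exists_eq_greedyValue q y
  -- The stationary greedy policy is its own shift, and along it `hdiff` compares `q` with itself,
  -- so the absolute error contracts.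
  have heq : expectedReturn P ρ β (fun _ => g) x b = q x b := by
    have hm (m : ℕ) : ∀ (x : S) (b : A),
        |expectedReturn P ρ β (fun _ => g) x b - q x b| ≤ β ^ m * ((1 - β)⁻¹ * C + D) := by
      induction m with
      | zero => intro x b; simpa using hbase _ x b
      | succ m ih =>
        intro x b
        rw [hdiff, pow_succ', mul_assoc, abs_mul, abs_of_nonneg hβ₀]
        refine mul_le_mul_of_nonneg_left (abs_sum_pmf_mul_le _ fun y => ?_) hβ₀
        rw [← hg y]
        exact ih y (g y)
    have h0 := ge_of_tendsto' hlim fun m => hm m x b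
    exact sub_eq_zero.1 (abs_nonpos_iff.1 h0)
  refine le_antisymm ?_ (ciSup_le fun π => hle π x b)
  rw [← heq]
  exact le_ciSup (f := fun π => expectedReturn P ρ β π x b)
    ⟨_, Set.forall_mem_range.2 fun π => hle π x b⟩ fun _ => g

end OptimalQ

/-! ### Convergence of weighted martingale differences -/

section Martingale

variable {Ω : Type*} {mΩ : MeasurableSpace Ω} {μ : Measure Ω}

variable {𝒢 : Filtration ℕ mΩ} {g w : ℕ → Ω → ℝ} {C : ℝ}

lemma measurable_weightedSum (hg : ∀ t, Measurable[𝒢 t] (g t))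
    (hw : ∀ t, Measurable[𝒢 (t + 1)] (w t)) (T : ℕ) :
    Measurable[𝒢 T] fun ω => ∑ t ∈ Finset.range T, g t ω * w t ω := by
  refine Finset.measurable_fun_sum _ fun t ht => ?_
  have h : t + 1 ≤ T := Finset.mem_range.1 ht
  exact ((hg t).mono (𝒢.mono ((Nat.le_succ t).trans h)) le_rfl).mul
    ((hw t).mono (𝒢.mono h) le_rfl)

lemma ae_abs_weightedSum_le (hg1 : ∀ t ω, |g t ω| ≤ 1) (hwC : ∀ t, ∀ᵐ ω ∂μ, |w t ω| ≤ C) (T : ℕ) :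
    ∀ᵐ ω ∂μ, |∑ t ∈ Finset.range T, g t ω * w t ω| ≤ T * C := by
  filter_upwards [ae_all_iff.2 hwC] with ω hω
  calc |∑ t ∈ Finset.range T, g t ω * w t ω| ≤ ∑ t ∈ Finset.range T, |g t ω * w t ω| :=
        Finset.abs_sum_le_sum_abs _ _
    _ ≤ ∑ t ∈ Finset.range T, C := by
        refine Finset.sum_le_sum fun t _ => ?_
        rw [abs_mul]
        nlinarith [hg1 t ω, hω t, abs_nonneg (g t ω), abs_nonneg (w t ω)]
    _ = T * C := by simp

variable [IsProbabilityMeasure μ]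

/-- A conditionally centred variable stays so after multiplication with a bounded known factor. -/
lemma condExp_mul_eq_zero {m : MeasurableSpace Ω} (hm : m ≤ mΩ) {g w : Ω → ℝ} {K : ℝ}
    (hg : Measurable[m] g) (hgK : ∀ᵐ ω ∂μ, |g ω| ≤ K) (hw : Integrable w μ)
    (hw0 : μ[w | m] =ᵐ[μ] 0) : μ[fun ω => g ω * w ω | m] =ᵐ[μ] 0 := by
  filter_upwards [condExp_stronglyMeasurable_mul_of_bound hm hg.stronglyMeasurable hw K hgK, hw0]
    with ω h1 h2
  have h1' : (μ[fun ω => g ω * w ω | m]) ω = (g * μ[w | m]) ω := h1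
  rw [h1', Pi.mul_apply, h2, Pi.zero_apply, mul_zero]

/-- The second moment of a sum of weighted martingale differences. -/
lemma integral_sq_weightedSum_le (hg : ∀ t, Measurable[𝒢 t] (g t)) (hg1 : ∀ t ω, |g t ω| ≤ 1)
    (hw : ∀ t, Measurable[𝒢 (t + 1)] (w t)) (hwC : ∀ t, ∀ᵐ ω ∂μ, |w t ω| ≤ C)
    (hw0 : ∀ t, μ[w t | 𝒢 t] =ᵐ[μ] 0) (T : ℕ) :
    ∫ ω, (∑ t ∈ Finset.range T, g t ω * w t ω) ^ 2 ∂μ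
      ≤ ∫ ω, C ^ 2 * ∑ t ∈ Finset.range T, g t ω ^ 2 ∂μ := by
  have hgm t : Measurable (g t) := (hg t).mono (𝒢.le t) le_rfl
  have hwm t : Measurable (w t) := (hw t).mono (𝒢.le _) le_rfl
  have hwi t : Integrable (w t) μ := .of_bound (hwm t).aestronglyMeasurable C (hwC t)
  set M : ℕ → Ω → ℝ := fun T ω => ∑ t ∈ Finset.range T, g t ω * w t ω with hM
  have hMm T : Measurable[𝒢 T] (M T) := measurable_weightedSum hg hw T
  have hMb T : ∀ᵐ ω ∂μ, |M T ω| ≤ T * C := ae_abs_weightedSum_le hg1 hwC T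
  have hMsq T : Integrable (fun ω => M T ω ^ 2) μ := by
    refine .of_bound (((hMm T).mono (𝒢.le T) le_rfl).pow_const 2).aestronglyMeasurable
      ((T * C) ^ 2) ?_
    filter_upwards [hMb T] with ω h
    rw [Real.norm_eq_abs, abs_pow]
    gcongr
  have hgi t : Integrable (fun ω => C ^ 2 * g t ω ^ 2) μ := by
    refine .of_bound (((hgm t).pow_const 2).const_mul _).aestronglyMeasurable (C ^ 2)
      (ae_of_all _ fun ω => ?_)
    have : g t ω ^ 2 ≤ 1 := (sq_le_one_iff_abs_le_one _).2 (hg1 t ω)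
    rw [Real.norm_eq_abs, abs_of_nonneg (by positivity)]
    nlinarith [sq_nonneg C]
  have hgwsq t : ∀ᵐ ω ∂μ, (g t ω * w t ω) ^ 2 ≤ C ^ 2 * g t ω ^ 2 := by
    filter_upwards [hwC t] with ω h
    have h2 : w t ω ^ 2 ≤ C ^ 2 := sq_le_sq.2 (h.trans (le_abs_self C))
    rw [mul_pow, mul_comm]
    gcongr
  have hgwi t : Integrable (fun ω => (g t ω * w t ω) ^ 2) μ := by
    refine (hgi t).mono' (((hgm t).mul (hwm t)).pow_const 2).aestronglyMeasurable ?_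
    filter_upwards [hgwsq t] with ω h
    rwa [Real.norm_eq_abs, abs_of_nonneg (sq_nonneg _)]
  -- Orthogonality of increments: `2 M g` is bounded and known at time `t`, while `w` is
  -- conditionally centred.
  have hcross t : ∫ ω, (2 * M t ω * g t ω) * w t ω ∂μ = 0 := by
    have h := condExp_mul_eq_zero (K := 2 * (t * C)) (𝒢.le t)
      (((hMm t).const_mul 2).mul (hg t)) (by
        filter_upwards [hMb t] with ω h
        change |2 * M t ω * g t ω| ≤ _
        rw [abs_mul, abs_mul, abs_two]
        nlinarith [hg1 t ω, abs_nonneg (g t ω), abs_nonneg (M t ω)]) (hwi t) (hw0 t)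
    have h2 := integral_congr_ae h
    rw [integral_condExp (𝒢.le t)] at h2
    simpa using h2
  have hcrossi t : Integrable (fun ω => (2 * M t ω * g t ω) * w t ω) μ := by
    refine (hwi t).bdd_mul (c := 2 * (t * C)) ((((hMm t).mono (𝒢.le t) le_rfl).const_mul 2).mul
      (hgm t)).aestronglyMeasurable ?_
    filter_upwards [hMb t] with ω h
    rw [Real.norm_eq_abs]
    rw [abs_mul, abs_mul, abs_two]
    nlinarith [hg1 t ω, abs_nonneg (g t ω), abs_nonneg (M t ω)]
  change ∫ ω, M T ω ^ 2 ∂μ ≤ _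
  induction T with
  | zero => simp [hM]
  | succ T ih =>
    have h1 : ∫ ω, M (T + 1) ω ^ 2 ∂μ = ∫ ω, M T ω ^ 2 ∂μ + ∫ ω, (g T ω * w T ω) ^ 2 ∂μ := by
      have h2 : (fun ω => M (T + 1) ω ^ 2) = fun ω =>
          (M T ω ^ 2 + (2 * M T ω * g T ω) * w T ω) + (g T ω * w T ω) ^ 2 := by
        funext ω
        simp only [hM, Finset.sum_range_succ]; ring
      have h3 : Integrable (fun ω => M T ω ^ 2 + (2 * M T ω * g T ω) * w T ω) μ :=
        (hMsq T).add (hcrossi T)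
      rw [h2, integral_add h3 (hgwi T), integral_add (hMsq T) (hcrossi T), hcross, add_zero]
    simp only [Finset.sum_range_succ, mul_add]
    rw [h1, integral_add _ (hgi T)]
    · exact add_le_add ih (integral_mono_ae (hgwi T) (hgi T) (hgwsq T))
    · simp only [Finset.mul_sum]
      exact integrable_finsetSum _ fun t _ => hgi t

/-- The partial sums form a martingale with second moments at most `C ^ 2 * N`, hence bounded in L¹
by `|x| ≤ 1 + x ^ 2`, and Doob's theorem applies. -/
lemma ae_exists_tendsto_of_sum_sq_le {N : ℝ} (hg : ∀ t, Measurable[𝒢 t] (g t))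
    (hg1 : ∀ t ω, |g t ω| ≤ 1) (hgN : ∀ T ω, ∑ t ∈ Finset.range T, g t ω ^ 2 ≤ N)
    (hw : ∀ t, Measurable[𝒢 (t + 1)] (w t)) (hwC : ∀ t, ∀ᵐ ω ∂μ, |w t ω| ≤ C)
    (hw0 : ∀ t, μ[w t | 𝒢 t] =ᵐ[μ] 0) :
    ∀ᵐ ω ∂μ, ∃ l, Tendsto (fun T => ∑ t ∈ Finset.range T, g t ω * w t ω) atTop (𝓝 l) := by
  have hgm t : Measurable (g t) := (hg t).mono (𝒢.le t) le_rfl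
  have hwm t : Measurable (w t) := (hw t).mono (𝒢.le _) le_rfl
  have hwi t : Integrable (w t) μ := .of_bound (hwm t).aestronglyMeasurable C (hwC t)
  set M : ℕ → Ω → ℝ := fun T ω => ∑ t ∈ Finset.range T, g t ω * w t ω with hM
  have hMm T : Measurable[𝒢 T] (M T) := measurable_weightedSum hg hw T
  have hMb T : ∀ᵐ ω ∂μ, |M T ω| ≤ T * C := ae_abs_weightedSum_le hg1 hwC T
  have hMm' T : Measurable (M T) := (hMm T).mono (𝒢.le T) le_rfl
  have hMi T : Integrable (M T) μ := .of_bound (hMm' T).aestronglyMeasurable _ (hMb T)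
  have hMsq T : Integrable (fun ω => M T ω ^ 2) μ := by
    refine .of_bound ((hMm' T).pow_const 2).aestronglyMeasurable ((T * C) ^ 2) ?_
    filter_upwards [hMb T] with ω h
    rw [Real.norm_eq_abs, abs_pow]
    gcongr
  have hmart : Martingale M 𝒢 μ := by
    refine martingale_of_condExp_sub_eq_zero_nat (fun T => (hMm T).stronglyMeasurable) hMi
      fun t => ?_
    have h : M (t + 1) - M t = fun ω => g t ω * w t ω := by
      funext ω
      simp only [hM, Pi.sub_apply, Finset.sum_range_succ]; ring
    rw [h]
    exact condExp_mul_eq_zero (𝒢.le t) (hg t) (ae_of_all _ (hg1 t)) (hwi t) (hw0 t)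
  have hL1 T : ∫ ω, ‖M T ω‖ ∂μ ≤ 1 + C ^ 2 * N := by
    calc ∫ ω, ‖M T ω‖ ∂μ ≤ ∫ ω, (1 + M T ω ^ 2) ∂μ := by
          refine integral_mono (hMi T).norm ((integrable_const 1).add (hMsq T)) fun ω => ?_
          simp only [Real.norm_eq_abs]
          nlinarith [sq_nonneg (|M T ω| - 1), sq_abs (M T ω), abs_nonneg (M T ω)]
      _ = 1 + ∫ ω, M T ω ^ 2 ∂μ := by
          rw [integral_add (integrable_const 1) (hMsq T)]; simp
      _ ≤ 1 + ∫ _, C ^ 2 * N ∂μ := by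
          refine add_le_add le_rfl ?_
          refine (integral_sq_weightedSum_le hg hg1 hw hwC hw0 T).trans
            (integral_mono_of_nonneg (ae_of_all _ fun ω => ?_) (integrable_const _)
              (ae_of_all _ fun ω => ?_))
          · exact mul_nonneg (sq_nonneg C) (Finset.sum_nonneg fun _ _ => sq_nonneg _)
          · exact mul_le_mul_of_nonneg_left (hgN T ω) (sq_nonneg C)
      _ = 1 + C ^ 2 * N := by simp
  refine hmart.submartingale.exists_ae_tendsto_of_bdd (R := (1 + C ^ 2 * N).toNNReal) fun T => ?_
  rw [eLpNorm_one_eq_lintegral_enorm, ← ofReal_integral_norm_eq_lintegral_enorm (hMi T)]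
  exact ENNReal.ofReal_le_ofReal (hL1 T)

/-- Weighted martingale differences are summable where the squared weights are. -/
lemma ae_exists_tendsto_of_summable_sq (hg : ∀ t, Measurable[𝒢 t] (g t))
    (hg1 : ∀ t ω, |g t ω| ≤ 1) (hgs : ∀ᵐ ω ∂μ, Summable fun t => g t ω ^ 2)
    (hw : ∀ t, Measurable[𝒢 (t + 1)] (w t)) (hwC : ∀ t, ∀ᵐ ω ∂μ, |w t ω| ≤ C)
    (hw0 : ∀ t, μ[w t | 𝒢 t] =ᵐ[μ] 0) :
    ∀ᵐ ω ∂μ, ∃ l, Tendsto (fun T => ∑ t ∈ Finset.range T, g t ω * w t ω) atTop (𝓝 l) := by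
  -- Localization: weights are switched off once their squares would sum past `N`. Including index
  -- `t` itself keeps the bound without overshoot, and the test is still known at time `t`.
  set h : ℕ → ℕ → Ω → ℝ := fun N t ω =>
    if ∑ u ∈ Finset.range (t + 1), g u ω ^ 2 ≤ N then g t ω else 0 with hh
  have hN (N : ℕ) : ∀ᵐ ω ∂μ, ∃ l,
      Tendsto (fun T => ∑ t ∈ Finset.range T, h N t ω * w t ω) atTop (𝓝 l) := by
    refine ae_exists_tendsto_of_sum_sq_le (N := N) (fun t => ?_) (fun t ω => ?_) (fun T ω => ?_)
      hw hwC hw0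
    · have hs : Measurable[𝒢 t] fun ω => ∑ u ∈ Finset.range (t + 1), g u ω ^ 2 :=
        Finset.measurable_fun_sum _ fun u hu => ((hg u).mono
          (𝒢.mono (Nat.lt_succ_iff.1 (Finset.mem_range.1 hu))) le_rfl).pow_const 2
      exact Measurable.ite (hs measurableSet_Iic) (hg t)
        measurable_const
    · simp only [hh]
      split_ifs
      · exact hg1 t ω
      · simp
    · have hle T : ∑ t ∈ Finset.range T, h N t ω ^ 2 ≤ ∑ t ∈ Finset.range T, g t ω ^ 2 := by
        refine Finset.sum_le_sum fun t _ => ?_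
        simp only [hh]
        split_ifs
        · exact le_rfl
        · simpa using sq_nonneg (g t ω)
      induction T with
      | zero => simp
      | succ T ih =>
        -- Either nothing has crossed the threshold up to `T`, or the weight at `T` is `0` and the
        -- previous bound persists.
        by_cases hc : ∑ u ∈ Finset.range (T + 1), g u ω ^ 2 ≤ N
        · exact (hle _).trans hc
        · rw [Finset.sum_range_succ]
          simpa [hh, hc] using ih
  filter_upwards [hgs, ae_all_iff.2 hN] with ω hs hω
  -- On this path the truncation at `N` never acts; countably many levels cover almost every path.
  obtain ⟨N, hN⟩ := exists_nat_ge (∑' t, g t ω ^ 2)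
  obtain ⟨l, hl⟩ := hω N
  refine ⟨l, hl.congr fun T => Finset.sum_congr rfl fun t _ => ?_⟩
  have hc : ∑ u ∈ Finset.range (t + 1), g u ω ^ 2 ≤ N :=
    (hs.sum_le_tsum _ fun _ _ => sq_nonneg _).trans hN
  simp [hh, hc]

end Martingale

/-! ### The update noise is a bounded martingale difference -/

section Noise

variable {Ω : Type*} {mΩ : MeasurableSpace Ω} {μ : Measure Ω}

lemma measurable_apply_of_finite {T : Type*} [Finite T] {m : MeasurableSpace Ω} {f : Ω → T}
    (hf : ∀ y, MeasurableSet[m] {ω | f ω = y}) {h : T → Ω → ℝ} (hh : ∀ y, Measurable[m] (h y)) :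
    Measurable[m] fun ω => h (f ω) ω := by
  intro u hu
  have h1 : (fun ω => h (f ω) ω) ⁻¹' u = ⋃ y, {ω | f ω = y} ∩ h y ⁻¹' u := by
    ext ω; simp
  rw [h1]
  exact MeasurableSet.iUnion fun y => (hf y).inter (hh y hu)

lemma measurable_greedyValue {S A : Type*} [Fintype A] [Nonempty A] {m : MeasurableSpace Ω}
    {q : Ω → S → A → ℝ} {y : S} (hq : ∀ b, Measurable[m] fun ω => q ω y b) :
    Measurable[m] fun ω => greedyValue (q ω) y := by
  have h : Measurable[m] (Finset.univ.sup' Finset.univ_nonempty fun b ω => q ω y b) :=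
    Finset.measurable_sup' _ fun b _ => hq b
  convert h using 1
  funext ω
  rw [Finset.sup'_apply]
  rfl

lemma condExp_sub_eq_zero {m : MeasurableSpace Ω} (hm : m ≤ mΩ) [IsFiniteMeasure μ] {f p : Ω → ℝ}
    (hf : Integrable f μ) (hp : μ[f | m] =ᵐ[μ] p) : μ[fun ω => f ω - p ω | m] =ᵐ[μ] 0 := by
  have h1 : (fun ω => f ω - p ω) =ᵐ[μ] f - μ[f | m] := by
    filter_upwards [hp] with ω h
    rw [Pi.sub_apply, h]
  refine (condExp_congr_ae h1).trans ((condExp_sub hf integrable_condExp m).trans ?_)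
  rw [condExp_of_stronglyMeasurable hm stronglyMeasurable_condExp integrable_condExp, sub_self]

/-- Splits the noise into centred successor indicators with coefficients depending only on the
current table, so that conditional expectations can be taken term by term. -/
lemma updateNoise_eq_sum {S A : Type*} [Fintype S] [DecidableEq S] [Fintype A] [Nonempty A]
    (P : S → A → PMF S) (β : ℝ) (q : S → A → ℝ) (x y : S) (b : A)
    (r r' : ℝ) : updateNoise P β q x y b r r' = (r - r') + ∑ z,
      β * greedyValue q z * ((if y = z then 1 else 0) - (P x b z).toReal) := by
  simp only [updateNoise, mul_sub, Finset.sum_sub_distrib, mul_ite, mul_one, mul_zero,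
    Finset.sum_ite_eq, Finset.mem_univ, if_true, Finset.mul_sum]
  congr 2
  exact Finset.sum_congr rfl fun z _ => by ring

variable {S A : Type*} [Fintype S] [DecidableEq S] [Fintype A] [Nonempty A] [DecidableEq A]
  {𝒢 : Filtration ℕ mΩ} {P : S → A → PMF S} {β : ℝ} {q₀ : S → A → ℝ}
  {s s' : ℕ → Ω → S} {a : ℕ → Ω → A} {r α : ℕ → Ω → ℝ}

/-- The table after `k` updates uses only experiences before `k`, whose rewards and successors are
known by time `k`. -/
lemma measurable_qTable (hs : ∀ t x, MeasurableSet[𝒢 t] {ω | s t ω = x})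
    (ha : ∀ t b, MeasurableSet[𝒢 t] {ω | a t ω = b}) (hα : ∀ t, Measurable[𝒢 t] (α t))
    (hs' : ∀ t x, MeasurableSet[𝒢 (t + 1)] {ω | s' t ω = x})
    (hr : ∀ t, Measurable[𝒢 (t + 1)] (r t)) (k : ℕ) (x : S) (b : A) :
    Measurable[𝒢 k] fun ω => qTable β q₀ (fun t => s t ω) (fun t => a t ω) (fun t => s' t ω)
      (fun t => r t ω) (fun t => α t ω) k x b := by
  induction k generalizing x b with
  | zero => exact measurable_const
  | succ k ih =>
    have hle : 𝒢 k ≤ 𝒢 (k + 1) := 𝒢.mono (Nat.le_succ k)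
    have hq x b := (ih x b).mono hle le_rfl
    have hα' : Measurable[𝒢 (k + 1)] (α k) := (hα k).mono hle le_rfl
    have hV : Measurable[𝒢 (k + 1)] fun ω => greedyValue (qTable β q₀ (fun t => s t ω)
        (fun t => a t ω) (fun t => s' t ω) (fun t => r t ω) (fun t => α t ω) k) (s' k ω) :=
      measurable_apply_of_finite (hs' k) (h := fun y ω => greedyValue (qTable β q₀ (fun t => s t ω)
        (fun t => a t ω) (fun t => s' t ω) (fun t => r t ω) (fun t => α t ω) k) y)
        fun y => measurable_greedyValue fun b => hq y b
    simp only [qTable]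
    refine Measurable.ite ((hle _ (hs k x)).inter (hle _ (ha k b))) ?_ (hq x b)
    exact ((hα'.const_sub 1).mul (hq x b)).add (hα'.mul ((hr k).add (hV.const_mul β)))

variable {C : ℝ}

/-- Along almost every run the weighted noise of the updates of a Q-table is summable. -/
lemma ae_exists_tendsto_updateNoise [IsProbabilityMeasure μ] (hβ₀ : 0 ≤ β) (hβ₁ : β < 1)
    (hs : ∀ t x, MeasurableSet[𝒢 t] {ω | s t ω = x})
    (ha : ∀ t b, MeasurableSet[𝒢 t] {ω | a t ω = b}) (hα : ∀ t, Measurable[𝒢 t] (α t))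
    (hs' : ∀ t x, MeasurableSet[𝒢 (t + 1)] {ω | s' t ω = x})
    (hr : ∀ t, Measurable[𝒢 (t + 1)] (r t)) (hrC : ∀ t ω, |r t ω| ≤ C)
    (hP : ∀ t x, μ[{ω | s' t ω = x}.indicator (fun _ => (1 : ℝ)) | 𝒢 t]
      =ᵐ[μ] fun ω => (P (s t ω) (a t ω) x).toReal)
    (hα1 : ∀ t ω, α t ω ∈ Set.Icc (0 : ℝ) 1) (x : S) (b : A)
    (hsq : ∀ᵐ ω ∂μ, Summable fun t => if s t ω = x ∧ a t ω = b then α t ω ^ 2 else 0) :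
    ∀ᵐ ω ∂μ, ∃ l, Tendsto (fun T => ∑ t ∈ Finset.range T,
      (if s t ω = x ∧ a t ω = b then α t ω else 0) *
        updateNoise P β (qTable β q₀ (fun t => s t ω) (fun t => a t ω) (fun t => s' t ω)
          (fun t => r t ω) (fun t => α t ω) t) (s t ω) (s' t ω) (a t ω) (r t ω)
          ((μ[r t | 𝒢 t]) ω)) atTop (𝓝 l) := by
  set q : ℕ → Ω → S → A → ℝ := fun t ω => qTable β q₀ (fun t => s t ω) (fun t => a t ω)
    (fun t => s' t ω) (fun t => r t ω) (fun t => α t ω) t with hq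
  have hqm t x b : Measurable[𝒢 t] fun ω => q t ω x b := measurable_qTable hs ha hα hs' hr t x b
  have hVm t z : Measurable[𝒢 t] fun ω => greedyValue (q t ω) z :=
    measurable_greedyValue fun b => hqm t z b
  have hVb t z ω : |greedyValue (q t ω) z| ≤ valueBound β C q₀ :=
    abs_greedyValue_le fun b => abs_qTable_le hβ₀ hβ₁ (fun k => hα1 k ω) (fun k => hrC k ω) t z b
  have hPm t z : Measurable[𝒢 t] fun ω => (P (s t ω) (a t ω) z).toReal :=
    measurable_apply_of_finite (hs t) (h := fun x ω => (P x (a t ω) z).toReal) fun x =>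
      measurable_apply_of_finite (ha t) (h := fun b _ => (P x b z).toReal) fun b =>
        measurable_const
  have hIm t z : Measurable[𝒢 (t + 1)] fun ω => if s' t ω = z then (1 : ℝ) else 0 :=
    Measurable.ite (hs' t z) measurable_const measurable_const
  have hI t z : (fun ω => if s' t ω = z then (1 : ℝ) else 0)
      = {ω | s' t ω = z}.indicator fun _ => (1 : ℝ) := by
    funext ω; simp [Set.indicator_apply]
  have hIi t z : Integrable (fun ω => if s' t ω = z then (1 : ℝ) else 0) μ := by
    refine .of_bound ((hIm t z).mono (𝒢.le _) le_rfl).aestronglyMeasurable 1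
      (ae_of_all _ fun ω => ?_)
    split_ifs <;> simp
  have hri t : Integrable (r t) μ :=
    .of_bound ((hr t).mono (𝒢.le _) le_rfl).aestronglyMeasurable C (ae_of_all _ (hrC t))
  have hP01 x b z : (P x b z).toReal ∈ Set.Icc (0 : ℝ) 1 :=
    ⟨ENNReal.toReal_nonneg, ENNReal.toReal_le_of_le_ofReal zero_le_one
      (by simpa using (P x b).coe_le_one z)⟩
  have hdi t z : Integrable (fun ω => (if s' t ω = z then (1 : ℝ) else 0)
      - (P (s t ω) (a t ω) z).toReal) μ := by
    refine (hIi t z).sub (.of_bound ((hPm t z).mono (𝒢.le t) le_rfl).aestronglyMeasurable 1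
      (ae_of_all _ fun ω => ?_))
    rw [Real.norm_eq_abs, abs_of_nonneg (hP01 _ _ _).1]
    exact (hP01 _ _ _).2
  have hVd t z : Integrable (fun ω => β * greedyValue (q t ω) z *
      ((if s' t ω = z then (1 : ℝ) else 0) - (P (s t ω) (a t ω) z).toReal)) μ := by
    refine (hdi t z).bdd_mul (c := β * valueBound β C q₀)
      (((hVm t z).mono (𝒢.le t) le_rfl).const_mul β).aestronglyMeasurable
      (ae_of_all _ fun ω => ?_)
    rw [Real.norm_eq_abs, abs_mul, abs_of_nonneg hβ₀]
    exact mul_le_mul_of_nonneg_left (hVb t z ω) hβ₀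
  refine ae_exists_tendsto_of_summable_sq (𝒢 := 𝒢)
    -- Reward and its conditional mean contribute `C` each; the sampled and averaged greedy values
    -- contribute one `valueBound` each.
    (C := (C + C) + β * (valueBound β C q₀ + valueBound β C q₀))
    (g := fun t ω => if s t ω = x ∧ a t ω = b then α t ω else 0)
    (w := fun t ω => updateNoise P β (q t ω) (s t ω) (s' t ω) (a t ω) (r t ω) ((μ[r t | 𝒢 t]) ω))
    (fun t => ?_) (fun t ω => ?_) ?_ (fun t => ?_) (fun t => ?_) (fun t => ?_)
  · exact Measurable.ite ((hs t x).inter (ha t b)) (hα t) measurable_const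
  · split_ifs
    · rw [abs_of_nonneg (hα1 t ω).1]; exact (hα1 t ω).2
    · simp
  · filter_upwards [hsq] with ω h
    exact h.congr fun t => by split_ifs <;> simp
  · simp only [updateNoise_eq_sum]
    have hle : 𝒢 t ≤ 𝒢 (t + 1) := 𝒢.mono (Nat.le_succ t)
    refine ((hr t).sub (stronglyMeasurable_condExp.measurable.mono hle le_rfl)).add
      (Finset.measurable_fun_sum _ fun z _ => ?_)
    exact (((hVm t z).mono hle le_rfl).const_mul β).mul
      ((hIm t z).sub ((hPm t z).mono hle le_rfl))
  · filter_upwards [ae_bdd_abs_condExp_of_ae_bdd_abs (m := 𝒢 t) (ae_of_all μ (hrC t))] with ω h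
    refine (abs_add_le _ _).trans (add_le_add ((abs_sub _ _).trans (add_le_add (hrC t ω) h)) ?_)
    rw [abs_mul, abs_of_nonneg hβ₀]
    exact mul_le_mul_of_nonneg_left ((abs_sub _ _).trans (add_le_add (hVb t _ ω)
      (abs_sum_pmf_mul_le _ fun z => hVb t z ω))) hβ₀
  · simp only [updateNoise_eq_sum]
    have h1 : μ[fun ω => r t ω - (μ[r t | 𝒢 t]) ω | 𝒢 t] =ᵐ[μ] 0 :=
      condExp_sub_eq_zero (𝒢.le t) (hri t) EventuallyEq.rfl
    have h2 z : μ[fun ω => β * greedyValue (q t ω) z * ((if s' t ω = z then (1 : ℝ) else 0)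
        - (P (s t ω) (a t ω) z).toReal) | 𝒢 t] =ᵐ[μ] 0 := by
      refine condExp_mul_eq_zero (K := β * valueBound β C q₀) (𝒢.le t) ((hVm t z).const_mul β)
        (ae_of_all _ fun ω => ?_) (hdi t z)
        (condExp_sub_eq_zero (𝒢.le t) (hIi t z) (by rw [hI]; exact hP t z))
      rw [abs_mul, abs_of_nonneg hβ₀]
      exact mul_le_mul_of_nonneg_left (hVb t z ω) hβ₀
    have h3 := condExp_add (μ := μ) ((hri t).sub (integrable_condExp (m := 𝒢 t) (f := r t)))
      (integrable_finsetSum' Finset.univ fun z _ => hVd t z) (𝒢 t)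
    have h4 := condExp_finsetSum (μ := μ) (s := Finset.univ) (fun z _ => hVd t z) (𝒢 t)
    have h5 : (fun ω => (r t ω - (μ[r t | 𝒢 t]) ω) + ∑ z, β * greedyValue (q t ω) z *
        ((if s' t ω = z then (1 : ℝ) else 0) - (P (s t ω) (a t ω) z).toReal))
        = (r t - μ[r t | 𝒢 t]) + ∑ z, fun ω => β * greedyValue (q t ω) z *
        ((if s' t ω = z then (1 : ℝ) else 0) - (P (s t ω) (a t ω) z).toReal) := by
      funext ω; simp
    rw [h5]
    filter_upwards [h1, ae_all_iff.2 h2, h3, h4] with ω e1 e2 e3 e4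
    rw [e3, Pi.add_apply, e4, Finset.sum_apply]
    simp only [e2, Pi.zero_apply, Finset.sum_const_zero, add_zero]
    exact e1

end Noise

end MultiAgentQ

end

/-! ### Assembly along almost every path -/

theorem theorem1 {ι : Type*} [Fintype ι] {S : ι → Type*} [∀ n, Fintype (S n)]
    [∀ n, DecidableEq (S n)] {A : Type*} [Fintype A] [Nonempty A] [DecidableEq A]
    {Ω : Type*} [mΩ : MeasurableSpace Ω] (μ : Measure Ω) [IsProbabilityMeasure μ]
    (ℱ : ι → Filtration ℕ mΩ) (P : ∀ n, S n → A → PMF (S n))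
    (β : ℝ) (hβ₀ : 0 ≤ β) (hβ₁ : β < 1)
    (newEpisode : Set ℕ) (explore : ι → ℕ → Ω → Prop)
    (R : MultiAgentQ.Run ι S A Ω)
    (hR : MultiAgentQ.IsMultiAgentQLearning R μ ℱ P β newEpisode explore)
    (hα : MultiAgentQ.RobbinsMonro R μ) :
    (∀ᵐ ω ∂μ, ∀ n x b, Tendsto
      (fun k : ℕ => R.MQ β (k + 1) ω n x b - R.MQstar μ ℱ P β (k + 1) ω n x b) atTop (𝓝 0)) ∧
    (∀ (n : ι) (ρ : S n → A → ℝ),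
      (∀ᵐ ω ∂μ, Tendsto (fun t : ℕ =>
        R.meanReward μ ℱ n t ω - ρ (R.state n t ω) (R.action n t ω)) atTop (𝓝 0)) →
      ∀ᵐ ω ∂μ, ∀ x b, Tendsto (fun k : ℕ => R.MQ β (k + 1) ω n x b) atTop
        (𝓝 (MultiAgentQ.optimalQ (P n) ρ β x b))) := by
  obtain ⟨C, hC⟩ := hR.reward_bdd
  have hnoise n : ∀ᵐ ω ∂μ, ∀ x b, ∃ l, Tendsto (fun T => ∑ t ∈ Finset.range T,
      (if R.state n t ω = x ∧ R.action n t ω = b then R.rate n t ω else 0) *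
        MultiAgentQ.updateNoise (P n) β (R.MQ β t ω n) (R.state n t ω) (R.next n t ω)
          (R.action n t ω) (R.reward n t ω) (R.meanReward μ ℱ n t ω)) atTop (𝓝 l) :=
    ae_all_iff.2 fun x => ae_all_iff.2 fun b =>
      MultiAgentQ.ae_exists_tendsto_updateNoise hβ₀ hβ₁ (hR.state_meas n) (hR.action_meas n)
        (hR.rate_meas n) (hR.next_meas n) (hR.reward_meas n) (hC n) (hR.transition n)
        (hα.mem_Icc n) x b (hα.sum_sq_finite n x b)
  have hsum n : ∀ᵐ ω ∂μ, ∀ x b, Tendsto (fun T => ∑ t ∈ Finset.range T,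
      if R.state n t ω = x ∧ R.action n t ω = b then R.rate n t ω else 0) atTop atTop :=
    ae_all_iff.2 fun x => ae_all_iff.2 fun b => hα.sum_infinite n x b
  have hmean n : ∀ᵐ ω ∂μ, ∀ t, |R.meanReward μ ℱ n t ω| ≤ C :=
    ae_all_iff.2 fun t => ae_bdd_abs_condExp_of_ae_bdd_abs (ae_of_all μ (hC n t))
  refine ⟨ae_all_iff.2 fun n => ?_, fun n ρ hρ => ?_⟩
  · filter_upwards [hnoise n, hsum n, hmean n] with ω h1 h2 h3 x b
    have h := MultiAgentQ.tendsto_qTable_sub_deckBellman hβ₀ hβ₁ (fun k => hα.mem_Icc n k ω)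
      (fun k => hC n k ω) h3 h2 h1 x b
    simp only [MultiAgentQ.Run.MQstar,
      MultiAgentQ.deckOptimal_eq_deckBellman hβ₀ fun k => hα.mem_Icc n k ω]
    exact h.comp (tendsto_add_atTop_nat 1)
  · obtain ⟨q, hq⟩ := MultiAgentQ.exists_bellman_solution (P n) ρ hβ₀ hβ₁
    filter_upwards [hnoise n, hsum n, hρ] with ω h1 h2 h3 x b
    rw [← MultiAgentQ.eq_optimalQ_of_bellman hβ₀ hβ₁ hq]
    exact (MultiAgentQ.tendsto_qTable_of_bellman hβ₀ hβ₁ (fun k => hα.mem_Icc n k ω)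
      (fun k => hC n k ω) h2 h1 h3 hq x b).comp (tendsto_add_atTop_nat 1)
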